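/- **Setting.** Let $\mathcal Y\subseteq\mathbb R$, let $\alpha,\alpha'\in(0,1)$, $\tau\in(0,1]$, $\delta>0$ and $\mu^*\in\mathbb R$ be fixed. For every number $L\ge 1$ of studies let $Y$ be a $\mathcal Y$-valued random variable (the prediction target; a constant is allowed) and let $\mathcal C_{1,\alpha},\dots,\mathcal C_{L,\alpha}$ be random subsets of $\mathbb R$ on a common probability space (the space, $Y$ and the sets may depend on $L$) with $$\mathbb P(Y\notin\mathcal C_{\ell,\alpha})\le\alpha,\qquad \ell=1,\dots,L .$$ Suppose that the sets are $\delta$-weakly dependent: for every $L$ there is a Gaussian vector $Z=(Z_1,\dots,Z_L)\sim N(\mu^*\mathbf 1_L,\Sigma)$, with covariance matrix $\Sigma=\Sigma^{(L)}=(\sigma_{ij})$ satisfying $\sigma_{\ell\ell}=1$ for all $\ell$ and $$\frac1{L^2}\sum_{i=1}^L\sum_{j=1}^L|\sigma_{ij}|=O(L^{-\delta})\qquad(L\to\infty),$$ such that for every $y\in\mathcal Y$ the membership indicators $\big(\mathbf 1(y\in\mathcal C_{\ell,\alpha})\big)_{\ell\le L}$ have the same joint law as $\big(\mathbf 1(|Z_\ell-y|\le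 z_{1-\alpha/2})\big)_{\ell\le L}$; equivalently, for every $I\subseteq\{1,\dots,L\}$, $$\mathbb P\big(y\in\mathcal C_{\ell,\alpha}\ \forall \ell\in I\big)=\mathbb P\Big(\frac{|Z_\ell-y|}{\sqrt{\sigma_{\ell\ell}}}\le z_{1-\alpha/2}\ \forall \ell\in I\Big),$$ where $z_{1-\alpha/2}$ is the $(1-\alpha/2)$-quantile of the standard normal distribution. Then $\mathbb P(y\notin\mathcal C_{1,\alpha})$ is the same for all $L$. Define the synthetic e-values $e_\ell(y)=\alpha^{-1}\mathbf 1(y\notin\mathcal C_{\ell,\alpha})$, their arithmetic mean $\bar e(y)=\frac1L\sum_{\ell=1}^L e_\ell(y)$ and the merged set $\bar{\mathcal C}_{\alpha'}=\{y\in\mathcal Y:\bar e(y)<\tau/\alpha'\}$. **Theorem.** For every $y\in\mathcal Y$ with $\mathbb P(y\notin\mathcal C_{1,\alpha})>\alpha\tau/\alpha'$, $$\lim_{L\to\infty}\mathbb P(y\notin\bar{\mathcal C}_{\alpha'})=1 .$$ -/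

import Mathlib

open MeasureTheory ProbabilityTheory Filter Topology Asymptotics

noncomputable section

/-- The `p`-quantile of the standard normal distribution, `inf {x | p ≤ Φ(x)}` for `0 < p < 1`. -/
def normalQuantile (p : ℝ) : ℝ :=
  sInf {x : ℝ | p ≤ cdf (gaussianReal 0 1) x}

/-- A triangular array of random sets: for every number `L` of studies there are `L` random
subsets `C L 0, …, C L (L - 1)` of `ℝ` on the probability space `(Ω L, P L)`, study `ℓ` having
control level `α L ℓ`. The array is `δ`-weakly dependent over the candidate space `𝒴`, with
Gaussian summary statistics `Z = (Z_1, …, Z_L) ∼ N(m L, S L)`, if `L⁻² ∑ i, ∑ j |S_ij| = O(L^(-δ))`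
as `L → ∞` and if, for every `y ∈ 𝒴`, the events `{y ∈ C L ℓ}` have the same joint probabilities as
the events `{|Z_ℓ - y| / √S_ℓℓ ≤ z_{1 - α_ℓ / 2}}`. Only the law of `Z` enters. -/
structure IsWeaklyDependent {Ω : ℕ → Type*} [∀ L, MeasurableSpace (Ω L)]
    (P : ∀ L, Measure (Ω L)) (𝒴 : Set ℝ) (C : ∀ L, Fin L → Ω L → Set ℝ) (α : ∀ L, Fin L → ℝ)
    (m : ∀ L, EuclideanSpace ℝ (Fin L)) (S : ∀ L, Matrix (Fin L) (Fin L) ℝ) (δ : ℝ) : Prop where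
  delta_pos : 0 < δ
  posSemidef : ∀ L, (S L).PosSemidef
  isBigO : (fun L : ℕ => ((L : ℝ) ^ 2)⁻¹ * ∑ i, ∑ j, |S L i j|)
    =O[atTop] fun L : ℕ => (L : ℝ) ^ (-δ)
  joint_probability : ∀ L, ∀ y ∈ 𝒴, ∀ I : Finset (Fin L),
    (P L).real {ω | ∀ ℓ ∈ I, y ∈ C L ℓ ω} =
      (multivariateGaussian (m L) (S L)).real
        {z | ∀ ℓ ∈ I, |z ℓ - y| / √(S L ℓ ℓ) ≤ normalQuantile (1 - α L ℓ / 2)}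

/-- The synthetic e-value `α⁻¹ · 1(y ∉ C)` of the candidate `y`, for a set `C` of level `α`. -/
def syntheticEValue (C : Set ℝ) (α : ℝ) (y : ℝ) : ℝ :=
  α⁻¹ * Cᶜ.indicator 1 y

/-- The aggregation function
`G_e(e; k) = (L choose k)⁻¹ ∑_{I ⊆ [L], |I| = k} ∏_{ℓ ∈ I} e_ℓ`. -/
def aggregateE {L : ℕ} (e : Fin L → ℝ) (k : ℕ) : ℝ :=
  (L.choose k : ℝ)⁻¹ * ∑ I ∈ (Finset.univ : Finset (Fin L)).powersetCard k, ∏ ℓ ∈ I, e ℓ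

/-- The merged set `{y ∈ 𝒴 | G_e(e(y); 1) < τ / α'}` obtained from the sets `C ℓ` with levels
`α ℓ`, where `e(y)` is the vector of synthetic e-values. -/
def mergedSetE {L : ℕ} (𝒴 : Set ℝ) (C : Fin L → Set ℝ) (α : Fin L → ℝ) (τ α' : ℝ) : Set ℝ :=
  {y ∈ 𝒴 | aggregateE (fun ℓ => syntheticEValue (C ℓ) (α ℓ) y) 1 < τ / α'}

end

/-! Fix `y`. Every set contains `y` with the same probability `p`, and the averaged e-value is `α⁻¹`
times the fraction of sets that miss `y`. That fraction has mean `1 - p > α * τ / α'`, so by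
Chebyshev it suffices that its variance, the average of the pairwise covariances of the membership
events, tends to 0 (`tendsto_measureReal_average_indicator_gt`). Each covariance is a function of
the correlation alone, by the representation in `multivariateGaussian_map_pair`, and vanishes as the
correlation does. Hence pairs with `|S i j| < η` contribute little, uniformly in `L`; the remaining
pairs are a vanishing proportion by Markov's inequality, since the average of `|S i j|` tends to 0.
-/

/-- Two coordinates with mean `m` and unit variance of a multivariate Gaussian vector, expressed
through independent Gaussian variables. -/
lemma multivariateGaussian_map_pair {ι : Type*} [Fintype ι] [DecidableEq ι]
    {μ : EuclideanSpace ℝ ι} {S : Matrix ι ι ℝ} (hS : S.PosSemidef) {i j : ι} {m : ℝ}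
    (hμi : μ i = m) (hμj : μ j = m) (hi : S i i = 1) (hj : S j j = 1) :
    (multivariateGaussian μ S).map (fun z => (z i, z j)) =
      ((gaussianReal m 1).prod (gaussianReal 0 1)).map
        (fun p => (p.1, m + S i j * (p.1 - m) + √(1 - S i j ^ 2) * p.2)) := by
  set ρ := S i j with hρ
  set G := multivariateGaussian μ S with hG
  have hid : HasGaussianLaw (id : EuclideanSpace ℝ ι → _) G := IsGaussian.hasGaussianLaw_id
  have hcoord (k : ι) : HasGaussianLaw (fun z : EuclideanSpace ℝ ι => z k) G :=
    hid.map_fun (EuclideanSpace.proj k)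
  have hmem (k : ι) : MemLp (fun z : EuclideanSpace ℝ ι => z k) 2 G := (hcoord k).memLp_two
  -- The regression residual `z j - ρ * z i` is uncorrelated with `z i`, hence independent of it by
  -- joint Gaussianity.
  have hpair : HasGaussianLaw (fun z : EuclideanSpace ℝ ι => (z i, z j - ρ * z i)) G := by
    have := hid.map_fun ((EuclideanSpace.proj i : EuclideanSpace ℝ ι →L[ℝ] ℝ).prod
      ((EuclideanSpace.proj j : EuclideanSpace ℝ ι →L[ℝ] ℝ) - ρ • EuclideanSpace.proj i))
    simpa using! this
  have hcov (k l : ι) : cov[fun z => z k, fun z => z l; G] = S k l :=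
    covariance_eval_multivariateGaussian hS k l
  have hmem' (k : ι) : MemLp (fun z : EuclideanSpace ℝ ι => ρ * z k) 2 G := (hmem k).const_mul ρ
  have hcov0 : cov[fun z => z i, fun z => z j - ρ * z i; G] = 0 := by
    rw [covariance_fun_sub_right (hmem i) (hmem j) (hmem' i), covariance_const_mul_right,
      hcov, hcov, hi, hρ]
    ring
  have hji : S j i = ρ := by rw [← hcov, covariance_comm, hcov]
  have hvar : Var[fun z => z j - ρ * z i; G] = 1 - ρ ^ 2 := by
    rw [← covariance_self (hpair.snd.aemeasurable),
      covariance_fun_sub_left (hmem j) (hmem' i)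
        (show MemLp (fun z : EuclideanSpace ℝ ι => z j - ρ * z i) 2 G from
          (hmem j).sub (hmem' i)),
      covariance_const_mul_left, hcov0,
      covariance_fun_sub_right (hmem j) (hmem j) (hmem' i), covariance_const_mul_right,
      hcov, hcov, hj, hji]
    ring
  have hmean (k : ι) : ∫ z, z k ∂G = μ k := by
    have h := (EuclideanSpace.proj k : EuclideanSpace ℝ ι →L[ℝ] ℝ).integral_comp_comm
      (μ := G) (φ := fun z => z) IsGaussian.integrable_fun_id
    simpa [hG] using h
  have hmeanW : ∫ z, (z j - ρ * z i) ∂G = m - ρ * m := by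
    rw [integral_sub (hcoord j).integrable ((hcoord i).integrable.const_mul ρ),
      integral_const_mul, hmean, hmean, hμi, hμj]
  have hlaw1 : G.map (fun z => z i) = gaussianReal m 1 := by
    rw [(measurePreserving_eval_multivariateGaussian hS).map_eq, hμi, hi, Real.toNNReal_one]
  -- Being a variance, `1 - ρ ^ 2` is nonnegative, so the square root below is a genuine one.
  have hnn : 0 ≤ 1 - ρ ^ 2 := hvar ▸ variance_nonneg _ _
  have hlaw2 : G.map (fun z => z j - ρ * z i) =
      (gaussianReal 0 1).map (fun w => (m - ρ * m) + √(1 - ρ ^ 2) * w) := by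
    have hcomp : (fun w : ℝ => (m - ρ * m) + √(1 - ρ ^ 2) * w) =
        (fun w => (m - ρ * m) + w) ∘ (fun w => √(1 - ρ ^ 2) * w) := rfl
    rw [hpair.snd.map_eq_gaussianReal, hmeanW, hvar, hcomp,
      ← Measure.map_map (by fun_prop) (by fun_prop), gaussianReal_map_const_mul,
      gaussianReal_map_const_add]
    congr 1
    · ring
    · ext
      simp [Real.sq_sqrt hnn, hnn]
  have hind := (indepFun_iff_map_prod_eq_prod_map_map (by fun_prop) (by fun_prop)).1
    (hpair.indepFun_of_covariance_eq_zero hcov0)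
  have hjoint : (fun z : EuclideanSpace ℝ ι => (z i, z j)) =
      (fun p : ℝ × ℝ => (p.1, ρ * p.1 + p.2)) ∘ (fun z => (z i, z j - ρ * z i)) := by
    ext z <;> simp
  rw [hjoint, ← Measure.map_map (by fun_prop) (by fun_prop), hind, hlaw1, hlaw2,
    ← Measure.map_id (μ := gaussianReal m 1), Measure.map_prod_map _ _ (by fun_prop) (by fun_prop),
    Measure.map_map (by fun_prop) (by fun_prop), Measure.map_id]
  congr 1
  ext p <;> simp
  ring

/-- The probability that two standardised Gaussian variables with correlation `ρ` both fall into
an interval tends to the product of the marginal probabilities as `ρ → 0`. -/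
lemma tendsto_gaussianReal_prod_interval (m y q : ℝ) :
    Tendsto (fun ρ : ℝ => ((gaussianReal m 1).prod (gaussianReal 0 1)).real
        {p | |p.1 - y| ≤ q ∧ |m + ρ * (p.1 - m) + √(1 - ρ ^ 2) * p.2 - y| ≤ q})
      (𝓝 0) (𝓝 ((gaussianReal m 1).real {x | |x - y| ≤ q} ^ 2)) := by
  set ν := (gaussianReal m 1).prod (gaussianReal 0 1) with hν
  have hmeas (ρ : ℝ) : MeasurableSet
      {p : ℝ × ℝ | |p.1 - y| ≤ q ∧ |m + ρ * (p.1 - m) + √(1 - ρ ^ 2) * p.2 - y| ≤ q} :=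
    .inter (measurableSet_le (f := fun p : ℝ × ℝ => |p.1 - y|) (by fun_prop) (by fun_prop))
      (measurableSet_le (f := fun p : ℝ × ℝ => |m + ρ * (p.1 - m) + √(1 - ρ ^ 2) * p.2 - y|) (by fun_prop) (by fun_prop))
  have hval : ν.real {p | |p.1 - y| ≤ q ∧ |m + p.2 - y| ≤ q} =
      (gaussianReal m 1).real {x | |x - y| ≤ q} ^ 2 := by
    have hset : {p : ℝ × ℝ | |p.1 - y| ≤ q ∧ |m + p.2 - y| ≤ q} =
        {x | |x - y| ≤ q} ×ˢ ((fun w => m + w) ⁻¹' {x | |x - y| ≤ q}) := rfl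
    have hmap : (gaussianReal 0 1).map (fun w => m + w) = gaussianReal m 1 := by
      rw [gaussianReal_map_const_add, zero_add]
    rw [hset, hν, measureReal_prod_prod, ← map_measureReal_apply (by fun_prop)
      (measurableSet_le (by fun_prop) (by fun_prop)), hmap, sq]
  -- Off this null boundary the indicators converge pointwise as `ρ → 0`.
  have hae : ∀ᵐ p ∂ν, |m + p.2 - y| ≠ q := by
    have hnull : ∀ᵐ w ∂(gaussianReal 0 1), |m + w - y| ≠ q := by
      have := nullSingletonClass_gaussianReal (μ := 0) (v := 1) one_ne_zero
      have h1 := (Set.toFinite ({q + y - m, -q + y - m} : Set ℝ)).countable.ae_notMem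
        (gaussianReal 0 1)
      filter_upwards [h1] with w hw h
      apply hw
      rcases abs_choice (m + w - y) with h' | h' <;> rw [h'] at h
      · left; linarith
      · right; rw [Set.mem_singleton_iff]; linarith
    exact Measure.quasiMeasurePreserving_snd.ae hnull
  rw [← hval]
  refine (ENNReal.tendsto_toReal (measure_ne_top _ _)).comp ?_
  refine tendsto_measure_of_ae_tendsto_indicator_of_isFiniteMeasure (𝓝 (0 : ℝ))
    (by simpa using hmeas 0) hmeas ?_
  filter_upwards [hae] with p hp
  have hcont : Tendsto (fun ρ : ℝ => |m + ρ * (p.1 - m) + √(1 - ρ ^ 2) * p.2 - y|) (𝓝 0)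
      (𝓝 |m + p.2 - y|) := by
    have : Continuous (fun ρ : ℝ => |m + ρ * (p.1 - m) + √(1 - ρ ^ 2) * p.2 - y|) := by fun_prop
    simpa using this.tendsto 0
  rcases lt_or_gt_of_ne hp with h | h
  · filter_upwards [hcont.eventually_lt_const h] with ρ hρ
    simp [h.le, hρ.le]
  · filter_upwards [hcont.eventually_const_lt h] with ρ hρ
    simp [h.not_ge, hρ.not_ge]

/-- Under a multivariate Gaussian law with unit variances, membership of two coordinates in an
interval is almost independent if their covariance is small, uniformly in the dimension. -/
lemma exists_forall_multivariateGaussian_pair_lt (m y q : ℝ) {ε : ℝ} (hε : 0 < ε) :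
    ∃ η > 0, ∀ (L : ℕ) (S : Matrix (Fin L) (Fin L) ℝ), S.PosSemidef → (∀ l, S l l = 1) →
      ∀ i j, |S i j| < η →
        (multivariateGaussian (WithLp.toLp 2 fun _ => m) S).real
          {z | |z i - y| ≤ q ∧ |z j - y| ≤ q} -
            (gaussianReal m 1).real {x | |x - y| ≤ q} ^ 2 < ε := by
  obtain ⟨η, hη, h⟩ := Metric.tendsto_nhds_nhds.1 (tendsto_gaussianReal_prod_interval m y q) ε hε
  refine ⟨η, hη, fun L S hS hvar i j hij => ?_⟩
  have hdist := h (x := S i j) (by simpa using hij)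
  have hmeas : MeasurableSet {p : ℝ × ℝ | |p.1 - y| ≤ q ∧ |p.2 - y| ≤ q} :=
    .inter (measurableSet_le (f := fun p : ℝ × ℝ => |p.1 - y|) (by fun_prop) (by fun_prop))
      (measurableSet_le (f := fun p : ℝ × ℝ => |p.2 - y|) (by fun_prop) (by fun_prop))
  have hmap := congrArg (fun ν => ν.real {p : ℝ × ℝ | |p.1 - y| ≤ q ∧ |p.2 - y| ≤ q})
    (multivariateGaussian_map_pair (μ := WithLp.toLp 2 fun _ => m) (m := m) hS (i := i) (j := j)
      rfl rfl (hvar i) (hvar j))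
  simp only [] at hmap
  rw [map_measureReal_apply (by fun_prop) hmeas, map_measureReal_apply (by fun_prop) hmeas] at hmap
  simp only [Set.preimage_ofPred_eq] at hmap
  rw [hmap]
  exact (abs_lt.1 hdist).2

/-- Aggregation of order one is the arithmetic mean. -/
lemma aggregateE_one {L : ℕ} (e : Fin L → ℝ) : aggregateE e 1 = (L : ℝ)⁻¹ * ∑ l, e l := by
  simp [aggregateE, Finset.powersetCard_one]

lemma covariance_indicator_one {Ω : Type*} [MeasurableSpace Ω] {P : Measure Ω}
    [IsProbabilityMeasure P] {A B : Set Ω} (hA : MeasurableSet A) (hB : MeasurableSet B) :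
    cov[A.indicator (1 : Ω → ℝ), B.indicator 1; P] = P.real (A ∩ B) - P.real A * P.real B := by
  have hmem {A : Set Ω} (hA : MeasurableSet A) : MemLp (A.indicator (1 : Ω → ℝ)) 2 P :=
    (memLp_const 1).indicator hA
  rw [covariance_eq_sub (hmem hA) (hmem hB), ← Set.inter_indicator_one,
    integral_indicator_one hA, integral_indicator_one hB, integral_indicator_one (hA.inter hB)]

/-- A weak law of large numbers for triangular arrays of events of equal probability whose pairwise
covariances are small on average. -/
lemma tendsto_measureReal_average_indicator_gt {Ω : ℕ → Type*} [∀ L, MeasurableSpace (Ω L)]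
    (P : ∀ L, Measure (Ω L)) [∀ L, IsProbabilityMeasure (P L)]
    {E : ∀ L, Fin L → Set (Ω L)} (hE : ∀ L l, MeasurableSet (E L l)) {p c : ℝ} (hcp : c < 1 - p)
    (hp : ∀ L l, (P L).real (E L l) = p)
    (hcov : ∀ ε > 0, ∀ᶠ L : ℕ in atTop,
      ((L : ℝ) ^ 2)⁻¹ * ∑ i, ∑ j, ((P L).real (E L i ∩ E L j) - p ^ 2) < ε) :
    Tendsto (fun L => (P L).real
      {ω | c ≤ (L : ℝ)⁻¹ * ∑ l, (E L l)ᶜ.indicator 1 ω}) atTop (𝓝 1) := by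
  -- The gap between the mean miss fraction and the threshold: a deviation below `d` keeps the
  -- fraction above `c`.
  set d := 1 - p - c with hd
  have hd0 : 0 < d := by linarith
  refine tendsto_order.2 ⟨fun a ha => ?_, fun a ha => .of_forall fun L =>
    measureReal_le_one.trans_lt ha⟩
  filter_upwards [hcov ((1 - a) * d ^ 2) (by have := sub_pos.2 ha; positivity),
    eventually_gt_atTop 0] with L hL hL0
  have hL0' : (L : ℝ) ≠ 0 := by positivity
  have hmem (l) : MemLp ((E L l).indicator (1 : Ω L → ℝ)) 2 (P L) :=
    (memLp_const 1).indicator (hE L l)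
  set M : Ω L → ℝ := fun ω => (L : ℝ)⁻¹ * ∑ l, (E L l).indicator 1 ω with hM
  have hMmem : MemLp M 2 (P L) := (memLp_finsetSum _ fun l _ => hmem l).const_mul _
  have hmean : ∫ ω, M ω ∂(P L) = p := by
    rw [hM, integral_const_mul, integral_finsetSum _
      fun l _ => (hmem l).integrable one_le_two]
    simp [integral_indicator_one, hE, hp, hL0']
  have hvar : Var[M; P L] =
      ((L : ℝ) ^ 2)⁻¹ * ∑ i, ∑ j, ((P L).real (E L i ∩ E L j) - p ^ 2) := by
    rw [hM, variance_const_mul, variance_fun_sum hmem, inv_pow]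
    simp_rw [covariance_indicator_one (hE L _) (hE L _), hp, sq]
  have hcheb : (P L).real {ω | d ≤ |M ω - p|} ≤ Var[M; P L] / d ^ 2 := by
    have h := meas_ge_le_variance_div_sq hMmem hd0
    rw [hmean] at h
    exact ENNReal.toReal_le_of_le_ofReal (div_nonneg (variance_nonneg _ _) (sq_nonneg _)) h
  have hcompl (ω) : (L : ℝ)⁻¹ * ∑ l, (E L l)ᶜ.indicator 1 ω = 1 - M ω := by
    simp [hM, Set.indicator_compl, mul_sub, hL0']
  have hcover : {ω | c ≤ (L : ℝ)⁻¹ * ∑ l, (E L l)ᶜ.indicator 1 ω} ∪ {ω | d ≤ |M ω - p|} =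
      Set.univ := by
    refine Set.eq_univ_of_forall fun ω => ?_
    by_cases h : d ≤ |M ω - p|
    · exact .inr h
    · left
      have := (abs_lt.1 (not_le.1 h)).2
      rw [Set.mem_ofPred_eq, hcompl]
      linarith
  have hunion := measureReal_union_le (μ := P L)
    {ω | c ≤ (L : ℝ)⁻¹ * ∑ l, (E L l)ᶜ.indicator 1 ω} {ω | d ≤ |M ω - p|}
  rw [hcover, probReal_univ] at hunion
  have hsmall : Var[M; P L] / d ^ 2 < 1 - a := by
    rw [hvar, div_lt_iff₀ (by positivity)]
    exact hL
  linarith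

theorem mainTheorem9 {Ω : ℕ → Type*} [∀ L, MeasurableSpace (Ω L)]
    (P : ∀ L, Measure (Ω L)) [∀ L, IsProbabilityMeasure (P L)]
    (𝒴 : Set ℝ) (Y : ∀ L, Ω L → ℝ) (C : ∀ L, Fin L → Ω L → Set ℝ)
    (hY : ∀ L, Measurable (Y L)) (hY𝒴 : ∀ L ω, Y L ω ∈ 𝒴)
    (hC : ∀ L (ℓ : Fin L), ∀ y ∈ 𝒴, MeasurableSet {ω | y ∈ C L ℓ ω})
    (α : ℝ) (hα : α ∈ Set.Ioo (0 : ℝ) 1)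
    (hmis : ∀ L (ℓ : Fin L), (P L).real {ω | Y L ω ∉ C L ℓ ω} ≤ α)
    (μstar δ : ℝ) (S : ∀ L, Matrix (Fin L) (Fin L) ℝ)
    (hvar : ∀ L (ℓ : Fin L), S L ℓ ℓ = 1)
    (hdep : IsWeaklyDependent P 𝒴 C (fun _ _ => α)
      (fun _ => WithLp.toLp 2 fun _ => μstar) S δ)
    (α' : ℝ) (hα' : α' ∈ Set.Ioo (0 : ℝ) 1) (τ : ℝ) (hτ : τ ∈ Set.Ioc (0 : ℝ) 1) :
    ∀ y ∈ {y ∈ 𝒴 | ∃ (L : ℕ) (hL : 0 < L),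
        (P L).real {ω | y ∉ C L ⟨0, hL⟩ ω} > α * τ / α'},
      Tendsto
        (fun L => (P L).real {ω | y ∉ mergedSetE 𝒴 (fun ℓ => C L ℓ ω) (fun _ => α) τ α'})
        atTop (𝓝 1) := by
  rintro y ⟨hy, L₀, hL₀, hmiss⟩
  set q := normalQuantile (1 - α / 2) with hq
  set p := (gaussianReal μstar 1).real {x | |x - y| ≤ q} with hpdef
  have hjoint (L : ℕ) (i j : Fin L) :
      (P L).real ({ω | y ∈ C L i ω} ∩ {ω | y ∈ C L j ω}) =
        (multivariateGaussian (WithLp.toLp 2 fun _ => μstar) (S L)).real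
          {z | |z i - y| ≤ q ∧ |z j - y| ≤ q} := by
    have h := hdep.joint_probability L y hy {i, j}
    simpa [hvar, hq, Set.ofPred_and] using h
  -- The diagonal case `i = j` gives the marginal; `p` does not depend on `L`, so the hypothesis at
  -- the single size `L₀` serves for all.
  have hp (L : ℕ) (l : Fin L) : (P L).real {ω | y ∈ C L l ω} = p := by
    have h := hjoint L l l
    simp only [Set.inter_self, and_self] at h
    have hlaw := (measurePreserving_eval_multivariateGaussian
      (μ := WithLp.toLp 2 fun _ => μstar) (hdep.posSemidef L) (i := l)).map_eq
    rw [hvar, Real.toNNReal_one] at hlaw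
    rw [h, hpdef, ← hlaw, map_measureReal_apply (by fun_prop)
      (measurableSet_le (by fun_prop) (by fun_prop))]
    rfl
  have hcp : α * τ / α' < 1 - p := by
    have hcompl : {ω | y ∉ C L₀ ⟨0, hL₀⟩ ω} = {ω | y ∈ C L₀ ⟨0, hL₀⟩ ω}ᶜ := rfl
    rw [hcompl, probReal_compl_eq_one_sub (hC L₀ _ y hy), hp] at hmiss
    exact hmiss
  have hS0 : Tendsto (fun L : ℕ => ((L : ℝ) ^ 2)⁻¹ * ∑ i, ∑ j, |S L i j|) atTop (𝓝 0) :=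
    hdep.isBigO.trans_tendsto
      ((tendsto_rpow_neg_atTop hdep.delta_pos).comp tendsto_natCast_atTop_atTop)
  have hcov : ∀ ε > 0, ∀ᶠ L : ℕ in atTop, ((L : ℝ) ^ 2)⁻¹ * ∑ i, ∑ j,
      ((P L).real ({ω | y ∈ C L i ω} ∩ {ω | y ∈ C L j ω}) - p ^ 2) < ε := by
    intro ε hε
    obtain ⟨η, hη, hpair⟩ :=
      exists_forall_multivariateGaussian_pair_lt μstar y q (half_pos hε)
    have hterm (L : ℕ) (i j : Fin L) :
        (P L).real ({ω | y ∈ C L i ω} ∩ {ω | y ∈ C L j ω}) - p ^ 2 ≤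
          ε / 2 + η⁻¹ * |S L i j| := by
      -- For a large covariance the bound is trivial, because `η⁻¹ * |S L i j|` is already at least
      -- 1.
      rcases lt_or_ge |S L i j| η with h | h
      · have h1 := hpair L (S L) (hdep.posSemidef L) (hvar L) i j h
        rw [← hjoint] at h1
        have h2 : 0 ≤ η⁻¹ * |S L i j| := by positivity
        linarith
      · have h1 : 1 ≤ η⁻¹ * |S L i j| := by
          rw [inv_mul_eq_div]
          exact (one_le_div hη).2 h
        have h2 : (P L).real ({ω | y ∈ C L i ω} ∩ {ω | y ∈ C L j ω}) ≤ 1 := measureReal_le_one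
        nlinarith [sq_nonneg p]
    have hsmall := hS0.eventually_lt_const (show 0 < η * (ε / 2) by positivity)
    filter_upwards [hsmall, eventually_gt_atTop 0] with L hL hL0
    calc
      _ ≤ ((L : ℝ) ^ 2)⁻¹ * ∑ i, ∑ j, (ε / 2 + η⁻¹ * |S L i j|) := by
        gcongr with i _ j _
        exact hterm L i j
      _ = ε / 2 + η⁻¹ * (((L : ℝ) ^ 2)⁻¹ * ∑ i, ∑ j, |S L i j|) := by
        simp only [Finset.sum_add_distrib, ← Finset.mul_sum, Finset.sum_const, Finset.card_univ,
          Fintype.card_fin, nsmul_eq_mul]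
        field_simp
      _ < ε / 2 + η⁻¹ * (η * (ε / 2)) := by gcongr
      _ = ε := by field_simp; ring
  refine (tendsto_measureReal_average_indicator_gt P (fun L l => hC L l y hy) hcp hp hcov).congr
    fun L => ?_
  congr 1
  ext ω
  have hagg : aggregateE (fun l => syntheticEValue (C L l ω) α y) 1 =
      α⁻¹ * ((L : ℝ)⁻¹ * ∑ l, {ω | y ∈ C L l ω}ᶜ.indicator 1 ω) := by
    have hind (l : Fin L) : (C L l ω)ᶜ.indicator (1 : ℝ → ℝ) y =
        {ω | y ∈ C L l ω}ᶜ.indicator 1 ω := rfl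
    simp only [aggregateE_one, syntheticEValue, hind, ← Finset.mul_sum]
    ring
  simp only [mergedSetE, Set.mem_ofPred_eq, hy, true_and, not_lt, hagg]
  -- The strict inequality defining the merged set makes exclusion the non-strict event `α * τ / α'
  -- ≤` miss fraction.
  rw [inv_mul_eq_div α, le_div_iff₀ hα.1, div_mul_eq_mul_div, mul_comm τ]
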